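/- Let $q \ge 17$ be an odd prime power and let $\mathrm{PG}(2,q)$ be the projective plane over $\mathbb{F}_q$ with homogeneous coordinates $(X,Y,Z)$. Let $\mathcal{C}$ be the conic $XY - Z^2 = 0$ and let $H = \{(1, s^4, s^2) : s \in \mathbb{F}_q\}$. A secant of $H$ is a line containing two distinct points of $H$, and a point outside $H$ is called $H$-free if it lies on no secant of $H$. A line is tangent (respectively external) to $\mathcal{C}$ if it meets $\mathcal{C}$ in exactly one point (respectively in no point), and a point not on $\mathcal{C}$ is internal if it lies on no tangent to $\mathcal{C}$. Then $H$ consists of $(q+1)/2$ points of $\mathcal{C}$, and the following hold. 1. If $q \equiv 1 \pmod 4$, then the $H$-free points not on $\mathcal{C}$ are exactly the internal points of $\mathcal{C}$ on the line $Z = 0$. 2. If $q \equiv 3 \pmod 4$, then the $H$-free points not on $\mathcal{C}$ are exactly the internal points of $\mathcal{C}$ on the line $Z = 0$ together with the point $(0,0,1)$. 3. The line $Z = 0$ is not external to $\mathcal{C}$, and no external line to $\mathcal{C}$ contains two distinct internal $H$-free points. So it is not true that for every set of $(q+1)/2$ points on a conic in $\mathrm{PG}(2,q)$ there is an external line containing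 two internal points that are free with respect to that set. -/

import Mathlib

open scoped LinearAlgebra.Projectivization

namespace ConicArc

/-- The projective plane over `F`. -/
abbrev PG (F : Type*) [Field F] : Type _ := ℙ F (Fin 3 → F)

/-- A line of the plane, given by its homogeneous coefficients `[u : v : w]`. -/
abbrev Line (F : Type*) [Field F] : Type _ := ℙ F (Fin 3 → F)

/-- The set of points of a line: the line `[u : v : w]` consists of the points `(x : y : z)`
with `x * u + y * v + z * w = 0`. -/
def Line.points {F : Type*} [Field F] (l : Line F) : Set (PG F) :=
  {P | Projectivization.orthogonal P l}

section Sets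

variable {F : Type*} [Field F]

/-- A secant of `K` is a line through (at least) two distinct points of `K`. -/
def IsSecant (K : Set (PG F)) (l : Line F) : Prop :=
  ∃ P ∈ K, ∃ Q ∈ K, P ≠ Q ∧ P ∈ Line.points l ∧ Q ∈ Line.points l

/-- A point outside `K` is `K`-free if it lies on no secant of `K`. -/
def IsFree (K : Set (PG F)) (P : PG F) : Prop :=
  P ∉ K ∧ ∀ l : Line F, IsSecant K l → P ∉ Line.points l

/-- A tangent to a conic `C` is a line meeting `C` in exactly one point. -/
def IsTangent (C : Set (PG F)) (l : Line F) : Prop :=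
  ∃! P : PG F, P ∈ C ∧ P ∈ Line.points l

/-- An external line to a conic `C` is a line disjoint from `C`. -/
def IsExternalLine (C : Set (PG F)) (l : Line F) : Prop :=
  ∀ P ∈ C, P ∉ Line.points l

/-- A point outside a conic `C` is internal if it lies on no tangent to `C`. -/
def IsInternal (C : Set (PG F)) (P : PG F) : Prop :=
  P ∉ C ∧ ∀ l : Line F, IsTangent C l → P ∉ Line.points l

end Sets

variable (F : Type*) [Field F]

/-- The conic `X * Y - Z ^ 2 = 0`. The equation is homogeneous, so the choice of representative
does not matter. -/
def conic : Set (PG F) :=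
  {P | P.rep 0 * P.rep 1 - P.rep 2 ^ 2 = 0}

theorem param_ne_zero (s : F) : (![1, s ^ 4, s ^ 2] : Fin 3 → F) ≠ 0 :=
  fun h => one_ne_zero (congrFun h 0)

/-- The set `H` of the points `(1, s ^ 4, s ^ 2)` with `s` in `F`. -/
def halfConic : Set (PG F) :=
  Set.range fun s : F => Projectivization.mk F ![1, s ^ 4, s ^ 2] (param_ne_zero F s)

theorem e_ne_zero : (![0, 0, 1] : Fin 3 → F) ≠ 0 :=
  fun h => one_ne_zero (congrFun h 2)

/-- The line `Z = 0`. -/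
def lineZ : Line F := Projectivization.mk F ![0, 0, 1] (e_ne_zero F)

/-- The point `(0, 0, 1)`. -/
def pointZ : PG F := Projectivization.mk F ![0, 0, 1] (e_ne_zero F)

end ConicArc

namespace ConicArc

/-! The affine points of the conic are `(1, t², t)`, and `H` takes the square values of `t`. The
chord through parameters `x²`, `y²` is `[x²y² : 1 : -(x² + y²)]`, so a point `(a, b, c)` off the
conic is free iff `a x²y² + b = c (x² + y²)` has no solution with `x² ≠ y²`. For `c = 0` this says
that `-ab` is a nonsquare, which is the internality criterion; for `a = b = 0` it says that `-1` is
a nonsquare.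

The core is `exists_sq_ne_sq`: for `c = 1` and the remaining `a`, `b` a solution always exists. If
`a = 0` or `b = 0`, this is a sum of two squares; if `b` is a square, take `y = 0`. Otherwise the
equation says `y² = φ(x²)` for the involution `φ(t) = (t - b)/(at - 1)`. Without solutions `φ` never
sends a square to a square, and a character sum then forces it to exchange squares and nonsquares.
With `k = ab`, the composite of `φ`, multiplication by `k`, and `φ` is `b/(1 + k - at)`. Hence
`χ(t(1 + k - at))` is constant off a few `t`, although its sum over the field is `±1`: impossible
for `q ≥ 17`. The case `k = -1` is settled by explicit values of `t`.

An internal free point therefore lies on `Z = 0`, and this line meets the conic. -/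

theorem exists_notMem_of_card_lt {α : Type*} [Fintype α] (s : Finset α)
    (hs : s.card < Fintype.card α) : ∃ x, x ∉ s := by
  by_contra! h
  rw [Finset.eq_univ_iff_forall.2 h, Finset.card_univ] at hs
  exact lt_irrefl _ hs

/-! ### Quadratic character sums and sums of two squares. -/

section CharacterSums

variable {F : Type*} [Field F] [Fintype F] [DecidableEq F]

local notation "χ" => quadraticChar F

theorem card_quadratic_roots_le (α β γ : F) (hα : α ≠ 0) :
    (Finset.univ.filter fun t : F => α * t ^ 2 + β * t + γ = 0).card ≤ 2 := by
  rcases Finset.eq_empty_or_nonempty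
    (Finset.univ.filter fun t : F => α * t ^ 2 + β * t + γ = 0) with h | ⟨r, hr⟩
  · rw [h]; simp
  · refine (Finset.card_le_card (t := {r, -β / α - r}) ?_).trans Finset.card_le_two
    intro t ht
    simp only [Finset.mem_filter, Finset.mem_univ, true_and, Finset.mem_insert,
      Finset.mem_singleton] at hr ht ⊢
    have : (t - r) * (α * (t + r) + β) = 0 := by linear_combination ht - hr
    rcases mul_eq_zero.1 this with h | h
    · exact Or.inl (sub_eq_zero.1 h)
    · right
      field_simp
      linear_combination h

theorem quadraticChar_le_one (t : F) : χ t ≤ 1 := by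
  rcases quadraticChar_isQuadratic F t with h | h | h <;> rw [h] <;> norm_num

theorem neg_one_le_quadraticChar (t : F) : -1 ≤ χ t := by
  rcases quadraticChar_isQuadratic F t with h | h | h <;> rw [h] <;> norm_num

/-- The quadratic character sum of a quadratic polynomial with roots `0` and `c / a`. -/
theorem sum_quadraticChar_mul_sub (h2 : ringChar F ≠ 2) {a c : F} (ha : a ≠ 0) (hc : c ≠ 0) :
    ∑ t, χ (t * (c - a * t)) = -χ (-a) := by
  have hJ : ∑ x : F, χ x * χ (1 - x) = -χ (-1) := by
    have := jacobiSum_nontrivial_inv (quadraticChar_ne_one h2)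
    rwa [(quadraticChar_isQuadratic F).inv] at this
  have hca : c / a ≠ 0 := div_ne_zero hc ha
  rw [← Equiv.sum_comp (Equiv.mulLeft₀ (c / a) hca)]
  have : ∀ x : F, χ (Equiv.mulLeft₀ (c / a) hca x * (c - a * Equiv.mulLeft₀ (c / a) hca x)) =
      χ a * (χ x * χ (1 - x)) := by
    intro x
    have e : Equiv.mulLeft₀ (c / a) hca x * (c - a * Equiv.mulLeft₀ (c / a) hca x) =
        (c / a) ^ 2 * (a * (x * (1 - x))) := by
      simp only [Equiv.mulLeft₀_apply]
      field_simp
    rw [e, map_mul, quadraticChar_sq_one' hca, one_mul, map_mul, map_mul]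
  rw [Finset.sum_congr rfl fun x _ => this x, ← Finset.mul_sum, hJ, neg_eq_neg_one_mul a, map_mul]
  ring

/-- Every nonzero element of a large finite field is a sum of two distinct nonzero squares. -/
theorem exists_sq_add_sq_eq (h2 : ringChar F ≠ 2) (hq : 17 ≤ Fintype.card F) {c : F} (hc : c ≠ 0) :
    ∃ x y : F, x ≠ 0 ∧ y ≠ 0 ∧ x ^ 2 ≠ y ^ 2 ∧ x ^ 2 + y ^ 2 = c := by
  by_contra! H
  have two : (2 : F) ≠ 0 := Ring.two_ne_zero h2
  -- The left side counts pairs with `x² = t`, `y² = c - t`. Without admissible pairs only `0`, `c`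
  -- and `c / 2` contribute, at most 2 + 2 + 4 = 8, whereas the total is `q - χ(-1)`.
  have hterm : ∀ t : F, (1 + χ t) * (1 + χ (c - t)) ≤
      2 * (if t = 0 then 1 else 0) + 2 * (if t = c then 1 else 0) +
        4 * (if t = c / 2 then 1 else 0) := by
    intro t
    have u1 := quadraticChar_le_one t
    have u2 := quadraticChar_le_one (c - t)
    have l1 := neg_one_le_quadraticChar t
    have l2 := neg_one_le_quadraticChar (c - t)
    by_cases h0 : t = 0
    · subst h0
      have : (0 : F) ≠ c / 2 := (div_ne_zero hc two).symm
      simp only [MulChar.map_zero, hc.symm, this, if_true, if_false]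
      linarith
    by_cases h1 : t = c
    · subst h1
      have : t ≠ t / 2 := by
        intro h
        field_simp at h
        exact one_ne_zero (α := F) (by linear_combination h)
      simp only [sub_self, MulChar.map_zero, hc, this, if_true, if_false]
      linarith
    by_cases h3 : t = c / 2
    · simp only [h3, if_true]
      split_ifs <;> nlinarith [quadraticChar_le_one (c / 2), quadraticChar_le_one (c - c / 2),
        neg_one_le_quadraticChar (c / 2), neg_one_le_quadraticChar (c - c / 2)]
    · simp only [h0, h1, h3, if_false, mul_zero, add_zero]
      have h1' : c - t ≠ 0 := sub_ne_zero.2 (Ne.symm h1)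
      rcases quadraticChar_dichotomy h0 with e | e
      · rcases quadraticChar_dichotomy h1' with e' | e'
        · obtain ⟨x, hx⟩ := (quadraticChar_one_iff_isSquare h0).1 e
          obtain ⟨y, hy⟩ := (quadraticChar_one_iff_isSquare h1').1 e'
          refine absurd (show x ^ 2 + y ^ 2 = c by linear_combination -hx - hy) (H x y ?_ ?_ ?_)
          · rintro rfl; exact h0 (by simpa using hx)
          · rintro rfl; exact h1' (by simpa using hy)
          · intro h
            apply h3
            field_simp
            linear_combination hx - hy + h
        · rw [e']; simp
      · rw [e]; simp
  have hsum := Finset.sum_le_sum fun t (_ : t ∈ Finset.univ) => hterm t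
  have h1 : ∑ t : F, (1 + χ t) * (1 + χ (c - t)) = Fintype.card F - χ (-1) := by
    have e : ∀ t : F, (1 + χ t) * (1 + χ (c - t)) =
        1 + χ t + χ (c - t) + χ (t * (c - 1 * t)) := by
      intro t; rw [map_mul, one_mul]; ring
    rw [Finset.sum_congr rfl fun t _ => e t]
    simp only [Finset.sum_add_distrib]
    rw [sum_quadraticChar_mul_sub h2 one_ne_zero hc, quadraticChar_sum_zero h2,
      show ∑ t, χ (c - t) = ∑ t, χ t from Equiv.sum_comp (Equiv.subLeft c) (χ ·),
      quadraticChar_sum_zero h2]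
    simp
    ring
  rw [h1] at hsum
  simp only [Finset.sum_add_distrib, ← Finset.mul_sum, Finset.sum_ite_eq', Finset.mem_univ,
    if_true] at hsum
  have := quadraticChar_le_one (-1 : F)
  have : (17 : ℤ) ≤ Fintype.card F := by exact_mod_cast hq
  linarith

end CharacterSums

/-! ### Secants of `H` through points off the line `Z = 0`. -/

section SecantPairs

variable {F : Type*} [Field F] [Fintype F] [DecidableEq F]

local notation "χ" => quadraticChar F

/-- The fixed points of the involution `t ↦ (t - b) / (a * t - 1)` have small character sum. -/
theorem sum_quadraticChar_fixed_le (h2 : ringChar F ≠ 2) {a b : F} (ha : a ≠ 0)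
    (hab : a * b ≠ 1) (hb : χ b = -1) :
    ∑ t ∈ Finset.univ.filter (fun t : F => a * t ^ 2 - 2 * t + b = 0), χ t ≤ 1 - χ a := by
  rcases Finset.eq_empty_or_nonempty
    (Finset.univ.filter fun t : F => a * t ^ 2 - 2 * t + b = 0) with h | ⟨r, hr⟩
  · rw [h, Finset.sum_empty]
    linarith [quadraticChar_le_one a]
  · simp only [Finset.mem_filter, Finset.mem_univ, true_and] at hr
    have hne : r ≠ 2 / a - r := by
      intro h
      field_simp at h
      have hr2 : 2 * (a * r - 1) = 0 := by linear_combination h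
      have hr1 := (mul_eq_zero.1 hr2).resolve_left (Ring.two_ne_zero h2)
      apply hab
      linear_combination a * hr - (a * r - 1) * hr1
    have hset : (Finset.univ.filter fun t : F => a * t ^ 2 - 2 * t + b = 0) = {r, 2 / a - r} := by
      ext t
      simp only [Finset.mem_filter, Finset.mem_univ, true_and, Finset.mem_insert,
        Finset.mem_singleton]
      constructor
      · intro ht
        have : (t - r) * (a * (t + r) - 2) = 0 := by linear_combination ht - hr
        rcases mul_eq_zero.1 this with h | h
        · exact Or.inl (sub_eq_zero.1 h)
        · right
          field_simp
          linear_combination h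
      · rintro (rfl | rfl)
        · exact hr
        · field_simp
          linear_combination a * hr
    rw [hset, Finset.sum_pair hne]
    -- By Vieta the fixed points have product `b / a`. Since `χ b = -1`, their characters are
    -- opposite if `χ a = 1` and equal if `χ a = -1`.
    have hprod : a * (r * (2 / a - r)) = b := by
      field_simp
      linear_combination -hr
    have hχ : χ a * (χ r * χ (2 / a - r)) = -1 := by rw [← map_mul, ← map_mul, hprod, hb]
    rcases quadraticChar_isQuadratic F a with h | h | h <;>
    rcases quadraticChar_isQuadratic F r with h' | h' | h' <;>
    rcases quadraticChar_isQuadratic F (2 / a - r) with h'' | h'' | h'' <;>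
    rw [h, h', h''] at hχ <;> rw [h, h', h''] <;> omega

/-- If no point of the curve `a x² y² + b = x² + y²` with `b` a nonsquare has `x² ≠ y²`, then the
involution `t ↦ (t - b) / (a * t - 1)` swaps squares and nonsquares away from its degeneracies. -/
theorem quadraticChar_mul_involution (h2 : ringChar F ≠ 2) {a b : F} (ha : a ≠ 0)
    (hab : a * b ≠ 1) (hb : χ b = -1)
    (H : ∀ x y : F, x ^ 2 ≠ y ^ 2 → a * (x ^ 2 * y ^ 2) + b ≠ x ^ 2 + y ^ 2)
    {t : F} (ht0 : t ≠ 0) (htb : t ≠ b) (hta : a * t ≠ 1) (htf : a * t ^ 2 - 2 * t + b ≠ 0) :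
    χ t * χ ((t - b) / (a * t - 1)) = -1 := by
  have hb0 : b ≠ 0 := by
    rintro rfl
    simp at hb
  set φ : F → F := fun t => (t - b) / (a * t - 1) with hφ
  -- `φ` permutes `X`: the pole `a⁻¹`, the pair `0`, `b` exchanged by `φ`, and the fixed points
  -- (where `x² = y²`) are removed.
  set X : Finset F := Finset.univ.filter
    (fun t => a * t ≠ 1 ∧ t ≠ b ∧ t ≠ 0 ∧ ¬ a * t ^ 2 - 2 * t + b = 0) with hX
  have hmul : ∀ t, a * t ≠ 1 → φ t * (a * t - 1) = t - b := fun t h =>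
    div_mul_cancel₀ _ (sub_ne_zero.2 h)
  have hmaps : ∀ t ∈ X, φ t ∈ X := by
    intro t ht
    simp only [hX, Finset.mem_filter, Finset.mem_univ, true_and] at ht ⊢
    obtain ⟨h1, h2, h3, h4⟩ := ht
    have e := hmul t h1
    have h1' := sub_ne_zero.2 h1
    refine ⟨fun h => hab ?_, fun h => ?_, fun h => h2 ?_, fun h => h4 ?_⟩
    · linear_combination a * e - (a * t - 1) * h
    · rw [h] at e
      have : t * (a * b - 1) = 0 := by linear_combination e
      exact (mul_ne_zero h3 (sub_ne_zero.2 hab)) this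
    · rw [h] at e
      linear_combination -e
    · have : (1 - a * b) * (a * t ^ 2 - 2 * t + b) = 0 := by
        linear_combination -(a * t - 1) ^ 2 * h +
          (a * (φ t * (a * t - 1) + (t - b)) - 2 * (a * t - 1)) * e
      exact (mul_eq_zero.1 this).resolve_left (sub_ne_zero.2 (Ne.symm hab))
  have hinv : ∀ t ∈ X, φ (φ t) = t := by
    intro t ht
    have ht' := hmaps t ht
    simp only [hX, Finset.mem_filter, Finset.mem_univ, true_and] at ht ht'
    have e := hmul t ht.1
    change (φ t - b) / (a * φ t - 1) = t
    rw [div_eq_iff (sub_ne_zero.2 ht'.1)]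
    linear_combination -e
  have hsymm : ∑ t ∈ X, χ (φ t) = ∑ t ∈ X, χ t :=
    Finset.sum_nbij' φ φ hmaps hmaps hinv hinv fun _ _ => rfl
  -- The character sums to zero over `F`; the removed points `b` and `a⁻¹` contribute `-1` and `χ
  -- a`.
  have hsumX : ∑ t ∈ X, χ t = 1 - χ a -
      ∑ t ∈ Finset.univ.filter (fun t : F => a * t ^ 2 - 2 * t + b = 0), χ t := by
    have hinv' : ∀ t, t = a⁻¹ ↔ a * t = 1 := fun t => by
      rw [← mul_right_inj' ha, mul_inv_cancel₀ ha]
    have hXe : X = (((Finset.univ.filter fun t : F =>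
        ¬ a * t ^ 2 - 2 * t + b = 0).erase 0).erase b).erase a⁻¹ := by
      ext t
      simp only [hX, Finset.mem_filter, Finset.mem_univ, true_and, Finset.mem_erase, ne_eq,
        hinv']
    have hsplit := Finset.sum_filter_add_sum_filter_not Finset.univ
      (fun t : F => a * t ^ 2 - 2 * t + b = 0) (fun t => χ t)
    rw [quadraticChar_sum_zero h2] at hsplit
    have hainv : χ a⁻¹ = χ a := by
      have h1 : χ a * χ a⁻¹ = 1 := by rw [← map_mul, mul_inv_cancel₀ ha, map_one]
      rcases quadraticChar_dichotomy ha with h | h <;> rw [h] at h1 ⊢ <;> linarith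
    rw [hXe, Finset.sum_erase_eq_sub, Finset.sum_erase_eq_sub, Finset.sum_erase_eq_sub,
      MulChar.map_zero, hb, hainv]
    · linarith
    · simpa using hb0
    · simp only [Finset.mem_erase, Finset.mem_filter, Finset.mem_univ, true_and]
      refine ⟨hb0, fun h => mul_ne_zero hb0 (sub_ne_zero.2 hab) ?_⟩
      linear_combination h
    · simp only [Finset.mem_erase, Finset.mem_filter, Finset.mem_univ, true_and]
      refine ⟨fun h => hab ?_, inv_ne_zero ha, fun h => hab ?_⟩
      · rw [← h, mul_inv_cancel₀ ha]
      · field_simp at h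
        linear_combination h
  have hnonpos : ∀ t ∈ X, χ t + χ (φ t) ≤ 0 := by
    intro t ht
    have ht' := hmaps t ht
    simp only [hX, Finset.mem_filter, Finset.mem_univ, true_and] at ht ht'
    rcases quadraticChar_dichotomy ht.2.2.1 with h | h
    · rcases quadraticChar_dichotomy ht'.2.2.1 with h' | h'
      · exfalso
        obtain ⟨x, hx⟩ := (quadraticChar_one_iff_isSquare ht.2.2.1).1 h
        obtain ⟨y, hy⟩ := (quadraticChar_one_iff_isSquare ht'.2.2.1).1 h'
        have e := hmul t ht.1
        rw [← sq] at hx hy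
        refine H x y (fun hxy => ht.2.2.2 ?_) ?_
        · rw [← hx, ← hy] at hxy
          rw [← hxy] at e
          linear_combination e
        · rw [← hx, ← hy]
          linear_combination e
      · rw [h, h']; norm_num
    · rw [h]; linarith [quadraticChar_le_one (φ t)]
  -- The terms are nonpositive, yet their sum is twice `∑ χ t` over `X`, which the fixed-point bound
  -- makes nonnegative. So every term vanishes.
  have hzero : ∑ t ∈ X, (χ t + χ (φ t)) = 0 := by
    refine le_antisymm (Finset.sum_nonpos hnonpos) ?_
    rw [Finset.sum_add_distrib, hsymm, hsumX]
    linarith [sum_quadraticChar_fixed_le h2 ha hab hb]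
  have := (Finset.sum_eq_zero_iff_of_nonpos hnonpos).1 hzero t (by
    simp only [hX, Finset.mem_filter, Finset.mem_univ, true_and]
    exact ⟨hta, htb, ht0, htf⟩)
  change χ t * χ (φ t) = -1
  rw [show χ (φ t) = -χ t by linarith]
  linarith [quadraticChar_sq_one ht0, sq (χ t)]

/-- A secant pair exists when `a * b ≠ -1`: twisting the square of the involution
`t ↦ (t - b) / (a * t - 1)` by `a * b` replaces a cubic character sum by a quadratic one. -/
theorem exists_sq_ne_sq_of_mul_ne_neg_one (h2 : ringChar F ≠ 2) (hq : 17 ≤ Fintype.card F)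
    {a b : F} (ha : a ≠ 0) (hab : a * b ≠ 1) (hab' : 1 + a * b ≠ 0) (hb : χ b = -1) :
    ∃ x y : F, x ^ 2 ≠ y ^ 2 ∧ a * (x ^ 2 * y ^ 2) + b = x ^ 2 + y ^ 2 := by
  by_contra! H
  have key := @quadraticChar_mul_involution F _ _ _ h2 a b ha hab hb H
  have hb0 : b ≠ 0 := by
    rintro rfl
    simp at hb
  obtain ⟨k, hk⟩ : ∃ k, k = a * b := ⟨_, rfl⟩
  rw [← hk] at hab hab'
  have hk0 : k ≠ 0 := hk ▸ mul_ne_zero ha hb0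
  have hk1 : k - 1 ≠ 0 := sub_ne_zero.2 hab
  set Q₁ : Finset F := Finset.univ.filter fun t => a * t ^ 2 + (-2) * t + b = 0 with hQ₁
  -- These are the `t` for which `k * φ(t)` is a fixed point of `φ`, after clearing denominators.
  set Q₂ : Finset F := Finset.univ.filter fun t =>
    (a * k * (k - 1)) * t ^ 2 + (2 * k ^ 2 * (1 - k)) * t + b * (k ^ 3 - 2 * k + 1) = 0 with hQ₂
  set B : Finset F := {b, a⁻¹} ∪ (Q₁ ∪ Q₂) with hB
  have hBcard : B.card ≤ 6 := by
    have h₁ : Q₁.card ≤ 2 := card_quadratic_roots_le _ _ _ ha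
    have h₂ : Q₂.card ≤ 2 :=
      card_quadratic_roots_le _ _ _ (mul_ne_zero (mul_ne_zero ha hk0) hk1)
    have h₃ : ({b, a⁻¹} : Finset F).card ≤ 2 := Finset.card_le_two
    have h₄ := Finset.card_union_le Q₁ Q₂
    have h₅ := Finset.card_union_le {b, a⁻¹} (Q₁ ∪ Q₂)
    rw [hB]
    omega
  have hgood : ∀ t, t ∉ B → t ≠ 0 → t ≠ (1 + k) / a →
      χ (k * b) * χ (t * (1 + k - a * t)) = 1 := by
    intro t htB ht0 htc
    simp only [hB, hQ₁, hQ₂, Finset.mem_union, Finset.mem_insert, Finset.mem_singleton,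
      Finset.mem_filter, Finset.mem_univ, true_and, not_or] at htB
    obtain ⟨⟨htb, hta⟩, hf₁, hf₂⟩ := htB
    have hta' : a * t ≠ 1 := fun h => hta (eq_inv_of_mul_eq_one_right h)
    have hta'' := sub_ne_zero.2 hta'
    have htc' : 1 + k - a * t ≠ 0 := fun h => htc (by
      field_simp
      linear_combination -h)
    obtain ⟨s, hs⟩ : ∃ s, s = (t - b) / (a * t - 1) := ⟨_, rfl⟩
    have e : s * (a * t - 1) = t - b := by rw [hs, div_mul_cancel₀ _ hta'']
    have hs0 : s ≠ 0 := hs ▸ div_ne_zero (sub_ne_zero.2 htb) hta''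
    have k₁ := key ht0 htb hta' (fun h => hf₁ (by linear_combination h))
    rw [← hs] at k₁
    have hus : a * (k * s) ≠ 1 := fun h => mul_ne_zero hk1 htc' (by
      linear_combination (-(a * t - 1)) * h + a * k * e + k * hk)
    have k₂ := key (t := k * s) (mul_ne_zero hk0 hs0)
      (fun h => hk1 (by
        have h' : a * s = 1 := by
          apply mul_right_cancel₀ hb0
          linear_combination h - s * hk
        linear_combination hk - (a * t - 1) * h' + a * e)) hus
      (fun h => hf₂ (by
        linear_combination (a * t - 1) ^ 2 * h -
          (a * k ^ 2 * (s * (a * t - 1) + (t - b)) - 2 * k * (a * t - 1)) * e +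
          (a * t ^ 2 + 2 * k * t - 2 * k ^ 2 * t + k ^ 2 * b - 2 * t) * hk))
    obtain ⟨p, hp⟩ : ∃ p, p = (k * s - b) / (a * (k * s) - 1) := ⟨_, rfl⟩
    rw [← hp] at k₂
    have ep : p * (a * (k * s) - 1) = k * s - b := by
      rw [hp, div_mul_cancel₀ _ (sub_ne_zero.2 hus)]
    have epb : p * (1 + k - a * t) = b := by
      -- In `φ(k φ(t))` the `t`-terms of the numerator cancel because `k = ab`, and a factor `k - 1`
      -- divides out.
      apply mul_right_cancel₀ (mul_ne_zero (sub_ne_zero.2 hus) hta'')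
      linear_combination (1 + k - a * t) * (a * t - 1) * ep +
        (k * (1 + k - a * t) - b * a * k) * e + (t * (1 + k - a * t) - b * k) * hk
    have hχ : χ p * χ (1 + k - a * t) = χ b := by rw [← map_mul, epb]
    have c₁ := quadraticChar_sq_one htc'
    have c₂ := quadraticChar_sq_one hs0
    rw [map_mul] at k₂
    rw [map_mul, map_mul]
    generalize χ t = T at *
    generalize χ s = S at *
    generalize χ k = K at *
    generalize χ (1 + k - a * t) = C at *
    generalize χ p = P at *
    generalize χ b = D at *
    linear_combination (-K * T * C) * hχ + K * T * P * c₁ - K * P * T * c₂ + K * S * P * k₁ - k₂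
  -- The value is at least `-1` on `B` and is `0` at the two roots. Summing gives `q - 2 * 6 - 2 ≤
  -- 1`, which fails for `q ≥ 17`.
  have hterm : ∀ t, 1 - 2 * (if t ∈ B then 1 else 0) - (if t = 0 then 1 else 0) -
      (if t = (1 + k) / a then 1 else 0) ≤ χ (k * b) * χ (t * (1 + k - a * t)) := by
    intro t
    by_cases h0 : t = 0
    · have : (0 : F) ≠ (1 + k) / a := (div_ne_zero hab' ha).symm
      subst h0
      simp only [zero_mul, MulChar.map_zero, mul_zero, if_true, this, if_false]
      split_ifs <;> norm_num
    by_cases h1 : t = (1 + k) / a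
    · have : 1 + k - a * t = 0 := by rw [h1, mul_div_cancel₀ _ ha, sub_self]
      rw [this, mul_zero, MulChar.map_zero, mul_zero, if_neg h0, if_pos h1]
      split_ifs <;> norm_num
    by_cases h3 : t ∈ B
    · rw [if_pos h3, if_neg h0, if_neg h1, ← map_mul]
      linarith [neg_one_le_quadraticChar (k * b * (t * (1 + k - a * t)))]
    · rw [if_neg h3, if_neg h0, if_neg h1, hgood t h3 h0 h1]
      norm_num
  have hsum := Finset.sum_le_sum fun t (_ : t ∈ Finset.univ) => hterm t
  rw [← Finset.mul_sum, sum_quadraticChar_mul_sub h2 ha hab'] at hsum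
  simp only [Finset.sum_sub_distrib, ← Finset.mul_sum, Finset.sum_ite_eq', Finset.mem_univ,
    if_true, Finset.sum_ite_mem, Finset.univ_inter, Finset.sum_const, Finset.card_univ,
    nsmul_eq_mul, mul_one] at hsum
  rw [mul_neg, ← map_mul] at hsum
  have h₁ := neg_one_le_quadraticChar (k * b * -a)
  have h₂ : (17 : ℤ) ≤ Fintype.card F := by exact_mod_cast hq
  have h₃ : (B.card : ℤ) ≤ 6 := by exact_mod_cast hBcard
  linarith

/-- A secant pair exists in the exceptional case `a * b = -1`. -/
theorem exists_sq_ne_sq_of_mul_eq_neg_one (h2 : ringChar F ≠ 2) (hq : 17 ≤ Fintype.card F)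
    {a b : F} (hab : a * b = -1) (hb : χ b = -1) :
    ∃ x y : F, x ^ 2 ≠ y ^ 2 ∧ a * (x ^ 2 * y ^ 2) + b = x ^ 2 + y ^ 2 := by
  by_contra! H
  have two : (2 : F) ≠ 0 := Ring.two_ne_zero h2
  have ha : a ≠ 0 := by
    rintro rfl
    simp at hab
  have hb0 : b ≠ 0 := by
    rintro rfl
    simp at hb
  have hab1 : a * b ≠ 1 := by
    rw [hab]
    exact fun h => two (by linear_combination -h)
  have key := @quadraticChar_mul_involution F _ _ _ h2 a b ha hab1 hb H
  have hsq : ∀ t : F, t ≠ 0 → χ t * χ (-t) = χ (-1) := by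
    intro t ht
    rw [← map_mul, show t * -t = t ^ 2 * -1 by ring, map_mul, quadraticChar_sq_one' ht, one_mul]
  rcases quadraticChar_dichotomy (neg_ne_zero.2 (one_ne_zero (α := F))) with h | h
  · obtain ⟨i, hi⟩ := (quadraticChar_one_iff_isSquare (neg_ne_zero.2 one_ne_zero)).1 h
    have hi1 : i - 1 ≠ 0 := fun h => two (by linear_combination -hi - (i + 1) * h)
    have hi1' : i + 1 ≠ 0 := fun h => two (by linear_combination -hi - (i - 1) * h)
    have hi0 : i ≠ 0 := by
      rintro rfl
      simp at hi
    -- Here `φ(bi) = -bi`, which has the same character as `bi` because `-1` is a square.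
    have ht : b * i ≠ 0 := mul_ne_zero hb0 hi0
    have hat : a * (b * i) ≠ 1 := fun h => hi1' (by linear_combination i * hab - h)
    have := key ht (fun h => mul_ne_zero hb0 hi1 (by linear_combination h)) hat
      (fun h => mul_ne_zero (mul_ne_zero two hb0) hi1 (by
        linear_combination -h - a * b ^ 2 * hi - b * hab))
    rw [show (b * i - b) / (a * (b * i) - 1) = -(b * i) by
      rw [div_eq_iff (sub_ne_zero.2 hat)]
      linear_combination b * i ^ 2 * hab + b * hi, hsq _ ht, h] at this
    norm_num at this
  · set Q₁ : Finset F := Finset.univ.filter fun t => a * t ^ 2 + (-2) * t + b = 0 with hQ₁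
    set Q₂ : Finset F := Finset.univ.filter fun t => a * t ^ 2 + 2 * t + b = 0 with hQ₂
    -- Now `t` and `-t` have opposite characters, while `φ(t) φ(-t) = b²` gives their images equal
    -- ones. The pole of `φ` is `-b`, so the excluded set handles both `t` and `-t`.
    obtain ⟨t, ht⟩ := exists_notMem_of_card_lt ({0, b, -b} ∪ (Q₁ ∪ Q₂)) (by
      have h₁ : Q₁.card ≤ 2 := card_quadratic_roots_le _ _ _ ha
      have h₂ : Q₂.card ≤ 2 := card_quadratic_roots_le _ _ _ ha
      have h₃ : ({0, b, -b} : Finset F).card ≤ 3 := Finset.card_le_three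
      have h₄ := Finset.card_union_le Q₁ Q₂
      have h₅ := Finset.card_union_le {0, b, -b} (Q₁ ∪ Q₂)
      omega)
    simp only [hQ₁, hQ₂, Finset.mem_union, Finset.mem_insert, Finset.mem_singleton,
      Finset.mem_filter, Finset.mem_univ, true_and, not_or] at ht
    obtain ⟨⟨ht0, htb, htb'⟩, hf₁, hf₂⟩ := ht
    have ha₁ : a * t ≠ 1 := fun h => htb' (by linear_combination t * hab - b * h)
    have ha₂ : a * -t ≠ 1 := fun h => htb (by linear_combination b * h + t * hab)
    have k₁ := key ht0 htb ha₁ (fun h => hf₁ (by linear_combination h))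
    have k₂ := key (neg_ne_zero.2 ht0) (fun h => htb' (by linear_combination -h)) ha₂
      (fun h => hf₂ (by linear_combination h))
    have hprod : (t - b) / (a * t - 1) * ((-t - b) / (a * -t - 1)) = b ^ 2 := by
      rw [div_mul_div_comm,
        div_eq_iff (mul_ne_zero (sub_ne_zero.2 ha₁) (sub_ne_zero.2 ha₂))]
      linear_combination (t ^ 2 * (a * b - 1)) * hab
    have hχ : χ ((t - b) / (a * t - 1)) * χ ((-t - b) / (a * -t - 1)) = 1 := by
      rw [← map_mul, hprod, quadraticChar_sq_one' hb0]
    have hneg := hsq t ht0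
    rw [h] at hneg
    have : (1 : ℤ) = -1 := by
      calc (1 : ℤ) = (χ t * χ ((t - b) / (a * t - 1))) *
            (χ (-t) * χ ((-t - b) / (a * -t - 1))) := by rw [k₁, k₂]; norm_num
        _ = (χ t * χ (-t)) *
            (χ ((t - b) / (a * t - 1)) * χ ((-t - b) / (a * -t - 1))) := by ring
        _ = -1 := by rw [hneg, hχ]; norm_num
    norm_num at this

/-- For `(a, b) ≠ (0, 0)` and `a * b ≠ 1`, the point `(a, b, 1)` lies on a line through two points
`(1, x⁴, x²)` and `(1, y⁴, y²)` with `x² ≠ y²`. -/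
theorem exists_sq_ne_sq (h2 : ringChar F ≠ 2) (hq : 17 ≤ Fintype.card F)
    {a b : F} (h0 : a ≠ 0 ∨ b ≠ 0) (hab : a * b ≠ 1) :
    ∃ x y : F, x ^ 2 ≠ y ^ 2 ∧ a * (x ^ 2 * y ^ 2) + b = x ^ 2 + y ^ 2 := by
  by_cases ha : a = 0
  · subst ha
    obtain ⟨x, y, -, -, hne, h⟩ := exists_sq_add_sq_eq h2 hq (h0.resolve_left (by simp))
    exact ⟨x, y, hne, by linear_combination -h⟩
  by_cases hb : b = 0
  · subst hb
    -- Dividing `a x²y² = x² + y²` by `x²y²` makes `a` a sum of two squares of inverses.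
    obtain ⟨x, y, hx, hy, hne, h⟩ := exists_sq_add_sq_eq h2 hq ha
    refine ⟨x⁻¹, y⁻¹, ?_, ?_⟩
    · rw [inv_pow, inv_pow]
      exact fun h => hne (inv_injective h)
    · field_simp
      linear_combination -h
  rcases quadraticChar_dichotomy hb with h | h
  · obtain ⟨x, hx⟩ := (quadraticChar_one_iff_isSquare hb).1 h
    refine ⟨x, 0, ?_, by linear_combination hx⟩
    intro h'
    exact hb (by linear_combination hx + h')
  · by_cases hk : 1 + a * b = 0
    · exact exists_sq_ne_sq_of_mul_eq_neg_one h2 hq (by linear_combination hk) h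
    · exact exists_sq_ne_sq_of_mul_ne_neg_one h2 hq ha hab hk h

end SecantPairs

/-! ### Coordinates for the conic, its tangents, and the secants of `H`. -/

section Coordinates

variable {F : Type*} [Field F]

theorem mk_mem_points_mk {v u : Fin 3 → F} (hv : v ≠ 0) (hu : u ≠ 0) :
    Projectivization.mk F v hv ∈ Line.points (Projectivization.mk F u hu) ↔
      v 0 * u 0 + v 1 * u 1 + v 2 * u 2 = 0 := by
  refine (Projectivization.orthogonal_mk hv hu).trans ?_
  rw [dotProduct, Fin.sum_univ_three]

theorem mk_mem_conic {v : Fin 3 → F} (hv : v ≠ 0) :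
    Projectivization.mk F v hv ∈ conic F ↔ v 0 * v 1 - v 2 ^ 2 = 0 := by
  obtain ⟨a, ha⟩ := Projectivization.exists_smul_eq_mk_rep F v hv
  have ha0 : (a : F) ^ 2 ≠ 0 := pow_ne_zero 2 a.ne_zero
  rw [conic, Set.mem_ofPred_eq, ← ha]
  simp only [Pi.smul_apply, Units.smul_def, smul_eq_mul]
  rw [show (a : F) * v 0 * (a * v 1) - (a * v 2) ^ 2 = a ^ 2 * (v 0 * v 1 - v 2 ^ 2) by ring,
    mul_eq_zero, or_iff_right ha0]

theorem mk_mem_lineZ {v : Fin 3 → F} (hv : v ≠ 0) :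
    Projectivization.mk F v hv ∈ Line.points (lineZ F) ↔ v 2 = 0 := by
  rw [lineZ, mk_mem_points_mk]
  simp

theorem mk_eq_pointZ {v : Fin 3 → F} (hv : v ≠ 0) :
    Projectivization.mk F v hv = pointZ F ↔ v 0 = 0 ∧ v 1 = 0 := by
  rw [pointZ, Projectivization.mk_eq_mk_iff']
  constructor
  · rintro ⟨a, rfl⟩
    simp
  · rintro ⟨h0, h1⟩
    refine ⟨v 2, funext fun i => ?_⟩
    fin_cases i <;> simp [h0, h1]

theorem vec_ne_zero_of_zero {x y z : F} (h : x ≠ 0) : (![x, y, z] : Fin 3 → F) ≠ 0 :=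
  fun e => h (congrFun e 0)

theorem vec_ne_zero_of_one {x y z : F} (h : y ≠ 0) : (![x, y, z] : Fin 3 → F) ≠ 0 :=
  fun e => h (congrFun e 1)

/-- The affine points of the conic. -/
def affinePoint (t : F) : PG F :=
  Projectivization.mk F ![1, t ^ 2, t] (vec_ne_zero_of_zero one_ne_zero)

theorem affinePoint_injective : Function.Injective (affinePoint (F := F)) := by
  intro s t h
  obtain ⟨a, ha⟩ := (Projectivization.mk_eq_mk_iff' _ _ _ _ _).1 h
  have h0 : a = 1 := by simpa using congrFun ha 0
  have h2 : a * t = s := by simpa using congrFun ha 2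
  rw [← h2, h0, one_mul]

theorem affinePoint_mem_conic (t : F) : affinePoint t ∈ conic F := by
  rw [affinePoint, mk_mem_conic]
  simp

theorem affinePoint_mem_points {u : Fin 3 → F} (hu : u ≠ 0) (t : F) :
    affinePoint t ∈ Line.points (Projectivization.mk F u hu) ↔
      u 0 + t ^ 2 * u 1 + t * u 2 = 0 := by
  rw [affinePoint, mk_mem_points_mk]
  simp

/-- The point of the conic at infinity. -/
def infinitePoint : PG F :=
  Projectivization.mk F ![0, 1, 0] (vec_ne_zero_of_one one_ne_zero)

theorem infinitePoint_mem_conic : (infinitePoint : PG F) ∈ conic F := by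
  rw [infinitePoint, mk_mem_conic]
  simp

theorem infinitePoint_mem_points {u : Fin 3 → F} (hu : u ≠ 0) :
    infinitePoint ∈ Line.points (Projectivization.mk F u hu) ↔ u 1 = 0 := by
  rw [infinitePoint, mk_mem_points_mk]
  simp

theorem affinePoint_ne_infinitePoint (t : F) : affinePoint t ≠ infinitePoint := by
  intro h
  obtain ⟨a, ha⟩ := (Projectivization.mk_eq_mk_iff' _ _ _ _ _).1 h
  simpa using congrFun ha 0

theorem eq_affinePoint_or_eq_infinitePoint {P : PG F} (hP : P ∈ conic F) :
    (∃ t, P = affinePoint t) ∨ P = infinitePoint := by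
  induction P using Projectivization.ind with
  | h v hv =>
    rw [mk_mem_conic] at hP
    by_cases h0 : v 0 = 0
    · right
      have h2 : v 2 = 0 := by
        rw [h0] at hP
        exact pow_eq_zero_iff two_ne_zero |>.1 (by linear_combination -hP)
      rw [infinitePoint, Projectivization.mk_eq_mk_iff']
      refine ⟨v 1, funext fun i => ?_⟩
      fin_cases i <;> simp [h0, h2]
    · left
      refine ⟨v 2 / v 0, ?_⟩
      rw [affinePoint, Projectivization.mk_eq_mk_iff']
      refine ⟨v 0, funext fun i => ?_⟩
      fin_cases i
      · simp
      · simp only [Fin.mk_one, Pi.smul_apply, Matrix.cons_val_one, Matrix.cons_val_zero,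
          smul_eq_mul]
        field_simp
        linear_combination -hP
      · simp only [Fin.reduceFinMk, Pi.smul_apply, Matrix.cons_val, smul_eq_mul]
        field_simp

theorem coeff_of_isTangent {u : Fin 3 → F} (hu : u ≠ 0)
    (h : IsTangent (conic F) (Projectivization.mk F u hu)) :
    (u 1 = 0 ∧ u 2 = 0) ∨ ∃ t, u 1 ≠ 0 ∧ u 0 = t ^ 2 * u 1 ∧ u 2 = -2 * t * u 1 := by
  obtain ⟨P, ⟨hPC, hPl⟩, huniq⟩ := h
  by_cases h1 : u 1 = 0
  · left
    refine ⟨h1, by_contra fun h2 => ?_⟩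
    have e₁ := huniq infinitePoint ⟨infinitePoint_mem_conic, (infinitePoint_mem_points hu).2 h1⟩
    have e₂ := huniq (affinePoint (-u 0 / u 2)) ⟨affinePoint_mem_conic _, by
      rw [affinePoint_mem_points, h1, div_mul_cancel₀ _ h2]
      ring⟩
    exact affinePoint_ne_infinitePoint _ (e₂.trans e₁.symm)
  · right
    rcases eq_affinePoint_or_eq_infinitePoint hPC with ⟨t, rfl⟩ | rfl
    · rw [affinePoint_mem_points] at hPl
      -- By Vieta this is the other root of `u 1 * t² + u 2 * t + u 0`; uniqueness makes the root
      -- double.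
      have e := affinePoint_injective (huniq (affinePoint (-u 2 / u 1 - t))
        ⟨affinePoint_mem_conic _, by
          rw [affinePoint_mem_points]
          field_simp
          linear_combination u 1 * hPl⟩)
      have e' : u 2 = -2 * t * u 1 := by
        field_simp at e
        linear_combination -e
      exact ⟨t, h1, by linear_combination hPl - t * e', e'⟩
    · exact absurd ((infinitePoint_mem_points hu).1 hPl) h1

theorem isTangent_affine (t : F) : IsTangent (conic F)
    (Projectivization.mk F ![t ^ 2, 1, -2 * t] (vec_ne_zero_of_one one_ne_zero)) := by
  refine ⟨affinePoint t, ⟨affinePoint_mem_conic t, ?_⟩, ?_⟩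
  · rw [affinePoint_mem_points]
    simp only [Matrix.cons_val]
    ring
  · rintro P ⟨hPC, hPl⟩
    rcases eq_affinePoint_or_eq_infinitePoint hPC with ⟨s, rfl⟩ | rfl
    · rw [affinePoint_mem_points] at hPl
      simp only [Matrix.cons_val] at hPl
      have : (s - t) ^ 2 = 0 := by linear_combination hPl
      rw [sub_eq_zero.1 (pow_eq_zero_iff two_ne_zero |>.1 this)]
    · rw [infinitePoint_mem_points] at hPl
      simp at hPl

theorem isTangent_infinite : IsTangent (conic F)
    (Projectivization.mk F ![1, 0, 0] (vec_ne_zero_of_zero one_ne_zero)) := by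
  refine ⟨infinitePoint, ⟨infinitePoint_mem_conic, ?_⟩, ?_⟩
  · rw [infinitePoint_mem_points]
    simp
  · rintro P ⟨hPC, hPl⟩
    rcases eq_affinePoint_or_eq_infinitePoint hPC with ⟨s, rfl⟩ | rfl
    · rw [affinePoint_mem_points] at hPl
      simp at hPl
    · rfl

/-- The tangent at parameter `t` passes through `v` iff `v 0 * t² - 2 * v 2 * t + v 1 = 0`, whose
quarter discriminant appears here; if `v 0 = 0`, the tangent at infinity contains `v`. -/
theorem isInternal_mk_iff {v : Fin 3 → F} (hv : v ≠ 0) :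
    IsInternal (conic F) (Projectivization.mk F v hv) ↔ ¬ IsSquare (v 2 ^ 2 - v 0 * v 1) := by
  constructor
  · rintro ⟨-, h⟩ ⟨d, hd⟩
    by_cases h0 : v 0 = 0
    · refine h _ isTangent_infinite ?_
      rw [mk_mem_points_mk]
      simp [h0]
    · refine h _ (isTangent_affine ((v 2 + d) / v 0)) ?_
      rw [mk_mem_points_mk]
      simp only [Matrix.cons_val]
      field_simp
      linear_combination -hd
  · intro h
    refine ⟨fun hC => h ⟨0, ?_⟩, fun l => ?_⟩
    · rw [mk_mem_conic] at hC
      linear_combination -hC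
    · induction l using Projectivization.ind with
      | h u hu =>
        intro hl hP
        rw [mk_mem_points_mk] at hP
        rcases coeff_of_isTangent hu hl with ⟨h1, h2⟩ | ⟨t, h1, h0, h2⟩
        · have hu0 : u 0 ≠ 0 := fun h0 => hu (funext fun i => by fin_cases i <;> simp [h0, h1, h2])
          rw [h1, h2] at hP
          have hv0 : v 0 = 0 := by simpa [hu0] using hP
          exact h ⟨v 2, by rw [hv0]; ring⟩
        · rw [h0, h2] at hP
          have : v 0 * t ^ 2 + v 1 - 2 * t * v 2 = 0 := by
            apply (mul_eq_zero.1 (?_ : u 1 * _ = 0)).resolve_left h1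
            linear_combination hP
          exact h ⟨v 0 * t - v 2, by linear_combination -v 0 * this⟩

theorem halfConic_eq_range : halfConic F = Set.range fun s : F => affinePoint (s ^ 2) := by
  unfold halfConic affinePoint
  simp only [← pow_mul]

theorem halfConic_subset_conic : halfConic F ⊆ conic F := by
  rw [halfConic_eq_range]
  rintro _ ⟨s, rfl⟩
  exact affinePoint_mem_conic _

theorem isFree_mk_iff {v : Fin 3 → F} (hv : v ≠ 0) (hC : Projectivization.mk F v hv ∉ conic F) :
    IsFree (halfConic F) (Projectivization.mk F v hv) ↔
      ∀ x y : F, x ^ 2 ≠ y ^ 2 → v 0 * (x ^ 2 * y ^ 2) + v 1 ≠ v 2 * (x ^ 2 + y ^ 2) := by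
  rw [halfConic_eq_range]
  constructor
  · rintro ⟨-, h⟩ x y hxy e
    refine h (Projectivization.mk F ![x ^ 2 * y ^ 2, 1, -(x ^ 2 + y ^ 2)]
      (vec_ne_zero_of_one one_ne_zero)) ⟨_, ⟨x, rfl⟩, _, ⟨y, rfl⟩, ?_, ?_, ?_⟩ ?_
    · exact fun h => hxy (affinePoint_injective h)
    · simp only [affinePoint_mem_points, Matrix.cons_val]
      ring
    · simp only [affinePoint_mem_points, Matrix.cons_val]
      ring
    · simp only [mk_mem_points_mk, Matrix.cons_val]
      linear_combination e
  · intro h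
    refine ⟨fun hH => hC ?_, fun l => ?_⟩
    · rw [← halfConic_eq_range] at hH
      exact halfConic_subset_conic hH
    induction l using Projectivization.ind with
    | h u hu =>
      rintro ⟨_, ⟨x, rfl⟩, _, ⟨y, rfl⟩, hne, hx, hy⟩ hP
      rw [affinePoint_mem_points] at hx hy
      rw [mk_mem_points_mk] at hP
      have hxy : x ^ 2 ≠ y ^ 2 := fun h => hne (congrArg (affinePoint (F := F)) h)
      have h2 : u 2 = -(x ^ 2 + y ^ 2) * u 1 := by
        have : (x ^ 2 - y ^ 2) * ((x ^ 2 + y ^ 2) * u 1 + u 2) = 0 := by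
          linear_combination hx - hy
        linear_combination (mul_eq_zero.1 this).resolve_left (sub_ne_zero.2 hxy)
      have h0 : u 0 = x ^ 2 * y ^ 2 * u 1 := by
        linear_combination hx - x ^ 2 * h2
      have h1 : u 1 ≠ 0 := fun h1 => hu (funext fun i => by
        fin_cases i <;> simp [h0, h1, h2])
      refine h x y hxy (mul_right_cancel₀ h1 ?_)
      rw [h0, h2] at hP
      linear_combination hP

theorem two_mul_ncard_halfConic [Fintype F] (h2 : ringChar F ≠ 2) :
    2 * (halfConic F).ncard = Fintype.card F + 1 := by
  classical
  have himg : halfConic F =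
      affinePoint '' ((Finset.univ.filter fun t : F => IsSquare t : Finset F) : Set F) := by
    rw [halfConic_eq_range]
    ext P
    simp only [Set.mem_range, Set.mem_image, Finset.coe_filter, Finset.mem_univ, true_and,
      Set.mem_ofPred_eq]
    constructor
    · rintro ⟨s, rfl⟩
      exact ⟨_, IsSquare.sq s, rfl⟩
    · rintro ⟨_, ⟨s, rfl⟩, rfl⟩
      exact ⟨s, by rw [sq]⟩
  rw [himg, Set.ncard_image_of_injective _ affinePoint_injective, Set.ncard_coe_finset]
  -- The last summand corrects for `0`, a square with character `0`.
  have hterm : ∀ t : F, 2 * (if IsSquare t then (1 : ℤ) else 0) =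
      quadraticChar F t + 1 + if t = 0 then 1 else 0 := by
    intro t
    by_cases h0 : t = 0
    · simp [h0]
    · by_cases hs : IsSquare t
      · simp [h0, hs, (quadraticChar_one_iff_isSquare h0).2 hs]
      · simp [h0, hs, quadraticChar_neg_one_iff_not_isSquare.2 hs]
  have hsum := Finset.sum_congr rfl fun t (_ : t ∈ (Finset.univ : Finset F)) => hterm t
  simp only [Finset.sum_add_distrib, ← Finset.mul_sum, quadraticChar_sum_zero h2,
    Finset.sum_ite_eq', Finset.mem_univ, if_true, Finset.sum_boole, Finset.sum_const,
    Finset.card_univ, nsmul_eq_mul, mul_one, zero_add] at hsum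
  exact_mod_cast hsum

theorem isFree_pointZ_iff (h2 : ringChar F ≠ 2) {v : Fin 3 → F} (hv : v ≠ 0)
    (hC : Projectivization.mk F v hv ∉ conic F) (h0 : v 0 = 0) (h1 : v 1 = 0) :
    IsFree (halfConic F) (Projectivization.mk F v hv) ↔ ¬ IsSquare (-1 : F) := by
  rw [isFree_mk_iff hv hC, h0, h1]
  rw [mk_mem_conic, h0] at hC
  have hc : v 2 ≠ 0 := fun h => hC (by rw [h]; ring)
  constructor
  · rintro h ⟨i, hi⟩
    refine h 1 i (fun e => Ring.two_ne_zero h2 ?_) (by linear_combination v 2 * hi)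
    linear_combination e - hi
  · intro h x y hxy e
    have hs : x ^ 2 + y ^ 2 = 0 := (mul_eq_zero.1 (by linear_combination -e)).resolve_left hc
    have hy : y ≠ 0 := by
      rintro rfl
      exact hxy (by linear_combination hs)
    refine h ⟨x / y, ?_⟩
    field_simp
    linear_combination -hs

theorem not_isInternal_of_eq_zero {v : Fin 3 → F} (hv : v ≠ 0) (h0 : v 0 = 0) :
    ¬ IsInternal (conic F) (Projectivization.mk F v hv) := by
  rw [isInternal_mk_iff, not_not]
  exact ⟨v 2, by rw [h0]; ring⟩

end Coordinates

/-! ### Free points off and on the line `Z = 0`. -/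

section FreePoints

variable {F : Type*} [Field F] [Fintype F]

theorem eq_zero_of_isFree (h2 : ringChar F ≠ 2) (hq : 17 ≤ Fintype.card F) {v : Fin 3 → F}
    (hv : v ≠ 0) (hC : Projectivization.mk F v hv ∉ conic F)
    (hfree : IsFree (halfConic F) (Projectivization.mk F v hv)) :
    v 2 = 0 ∨ (v 0 = 0 ∧ v 1 = 0) := by
  classical
  by_contra! h
  obtain ⟨hc, h01⟩ := h
  rw [isFree_mk_iff hv hC] at hfree
  rw [mk_mem_conic] at hC
  obtain ⟨x, y, hxy, e⟩ := exists_sq_ne_sq h2 hq (a := v 0 / v 2) (b := v 1 / v 2)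
    (by
      by_cases h0 : v 0 = 0
      · exact Or.inr (div_ne_zero (h01 h0) hc)
      · exact Or.inl (div_ne_zero h0 hc))
    (fun h => hC (by
      field_simp at h
      linear_combination h))
  refine hfree x y hxy ?_
  field_simp at e
  linear_combination e

theorem isFree_iff_isInternal (hq : 17 ≤ Fintype.card F) {v : Fin 3 → F} (hv : v ≠ 0)
    (hC : Projectivization.mk F v hv ∉ conic F) (hZ : v 2 = 0) :
    IsFree (halfConic F) (Projectivization.mk F v hv) ↔
      IsInternal (conic F) (Projectivization.mk F v hv) := by
  classical
  rw [isFree_mk_iff hv hC, isInternal_mk_iff, hZ]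
  rw [mk_mem_conic, hZ] at hC
  have h0 : v 0 ≠ 0 := fun h => hC (by rw [h]; ring)
  have h1 : v 1 ≠ 0 := fun h => hC (by rw [h]; ring)
  constructor
  · rintro h ⟨d, hd⟩
    set Q₁ : Finset F := Finset.univ.filter fun t => 1 * t ^ 2 + 0 * t + d / v 0 = 0 with hQ₁
    set Q₂ : Finset F := Finset.univ.filter fun t => 1 * t ^ 2 + 0 * t + -(d / v 0) = 0 with hQ₂
    -- A secant pair needs `(xy)² = (d / v 0)²`. Any `x ≠ 0` with `y = d / v 0 / x` works, provided
    -- `x² ≠ ± d / v 0`, so that `x² ≠ y²`.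
    obtain ⟨x, hx⟩ := exists_notMem_of_card_lt ({0} ∪ (Q₁ ∪ Q₂)) (by
      have h₁ : Q₁.card ≤ 2 := card_quadratic_roots_le _ _ _ one_ne_zero
      have h₂ : Q₂.card ≤ 2 := card_quadratic_roots_le _ _ _ one_ne_zero
      have h₃ : ({0} : Finset F).card = 1 := Finset.card_singleton _
      have h₄ := Finset.card_union_le Q₁ Q₂
      have h₅ := Finset.card_union_le {0} (Q₁ ∪ Q₂)
      omega)
    simp only [hQ₁, hQ₂, Finset.mem_union, Finset.mem_singleton,
      Finset.mem_filter, Finset.mem_univ, true_and, not_or] at hx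
    obtain ⟨hx0, hx₁, hx₂⟩ := hx
    refine h x (d / v 0 / x) (fun e => mul_ne_zero hx₁ hx₂ ?_) ?_
    · have e' : x ^ 2 * x ^ 2 = (d / v 0) ^ 2 := by
        rw [div_pow _ x, eq_div_iff (pow_ne_zero 2 hx0)] at e
        exact e
      linear_combination e'
    · have e : x ^ 2 * (d / v 0 / x) ^ 2 = (d / v 0) ^ 2 := by
        rw [← mul_pow, mul_div_cancel₀ _ hx0]
      have e' : v 0 * (d / v 0) = d := mul_div_cancel₀ _ h0
      rw [e]
      apply mul_left_cancel₀ h0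
      linear_combination (v 0 * (d / v 0) + d) * e' - hd
  · intro h x y _ e
    exact h ⟨v 0 * x * y, by linear_combination -v 0 * e⟩

end FreePoints

end ConicArc

theorem mainTheorem2 {F : Type*} [Field F] [Fintype F] (q : ℕ) (hF : Fintype.card F = q)
    (hodd : Odd q) (hq : 17 ≤ q) :
    -- `H` is a set of `(q + 1) / 2` points of the conic
    (ConicArc.halfConic F ⊆ ConicArc.conic F ∧ 2 * (ConicArc.halfConic F).ncard = q + 1) ∧
    -- the `H`-free points off the conic, for `q ≡ 1 (mod 4)`
    (q ≡ 1 [MOD 4] →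
      {P : ConicArc.PG F | P ∉ ConicArc.conic F ∧ ConicArc.IsFree (ConicArc.halfConic F) P} =
        {P | ConicArc.IsInternal (ConicArc.conic F) P ∧
          P ∈ ConicArc.Line.points (ConicArc.lineZ F)}) ∧
    -- the `H`-free points off the conic, for `q ≡ 3 (mod 4)`
    (q ≡ 3 [MOD 4] →
      {P : ConicArc.PG F | P ∉ ConicArc.conic F ∧ ConicArc.IsFree (ConicArc.halfConic F) P} =
        {P | ConicArc.IsInternal (ConicArc.conic F) P ∧
          P ∈ ConicArc.Line.points (ConicArc.lineZ F)} ∪ {ConicArc.pointZ F}) ∧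
    -- `Z = 0` is not an external line
    ¬ ConicArc.IsExternalLine (ConicArc.conic F) (ConicArc.lineZ F) ∧
    -- no external line carries two internal `H`-free points
    ¬ ∃ l : ConicArc.Line F, ConicArc.IsExternalLine (ConicArc.conic F) l ∧
      ∃ P₁ P₂ : ConicArc.PG F, P₁ ≠ P₂ ∧
        P₁ ∈ ConicArc.Line.points l ∧ P₂ ∈ ConicArc.Line.points l ∧
        ConicArc.IsInternal (ConicArc.conic F) P₁ ∧
        ConicArc.IsInternal (ConicArc.conic F) P₂ ∧
        ConicArc.IsFree (ConicArc.halfConic F) P₁ ∧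
        ConicArc.IsFree (ConicArc.halfConic F) P₂ := by
  subst hF
  have h2 : ringChar F ≠ 2 := fun h => by
    have := FiniteField.even_card_of_char_two h
    rw [Nat.odd_iff] at hodd
    omega
  refine ⟨⟨ConicArc.halfConic_subset_conic, ConicArc.two_mul_ncard_halfConic h2⟩, ?_, ?_, ?_, ?_⟩
  · intro hmod
    have hsq : IsSquare (-1 : F) := FiniteField.isSquare_neg_one_iff.2 (by
      rw [show Fintype.card F % 4 = 1 from hmod]; norm_num)
    ext P
    induction P using Projectivization.ind with
    | h v hv =>
      simp only [Set.mem_ofPred_eq, ConicArc.mk_mem_lineZ]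
      constructor
      · rintro ⟨hC, hfree⟩
        rcases ConicArc.eq_zero_of_isFree h2 hq hv hC hfree with hZ | ⟨h0, h1⟩
        · exact ⟨(ConicArc.isFree_iff_isInternal hq hv hC hZ).1 hfree, hZ⟩
        · exact absurd hsq ((ConicArc.isFree_pointZ_iff h2 hv hC h0 h1).1 hfree)
      · rintro ⟨hint, hZ⟩
        exact ⟨hint.1, (ConicArc.isFree_iff_isInternal hq hv hint.1 hZ).2 hint⟩
  · intro hmod
    have hsq : ¬ IsSquare (-1 : F) := by
      rw [FiniteField.isSquare_neg_one_iff, not_not]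
      exact hmod
    ext P
    induction P using Projectivization.ind with
    | h v hv =>
      simp only [Set.mem_ofPred_eq, Set.mem_union, Set.mem_singleton_iff, ConicArc.mk_mem_lineZ,
        ConicArc.mk_eq_pointZ]
      constructor
      · rintro ⟨hC, hfree⟩
        exact (ConicArc.eq_zero_of_isFree h2 hq hv hC hfree).imp_left fun hZ =>
          ⟨(ConicArc.isFree_iff_isInternal hq hv hC hZ).1 hfree, hZ⟩
      · rintro (⟨hint, hZ⟩ | ⟨h0, h1⟩)
        · exact ⟨hint.1, (ConicArc.isFree_iff_isInternal hq hv hint.1 hZ).2 hint⟩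
        · have hC : Projectivization.mk F v hv ∉ ConicArc.conic F := by
            rw [ConicArc.mk_mem_conic, h0]
            intro h
            have hZ : v 2 = 0 := pow_eq_zero_iff two_ne_zero |>.1 (by linear_combination -h)
            exact hv (funext fun i => by fin_cases i <;> simp [h0, h1, hZ])
          exact ⟨hC, (ConicArc.isFree_pointZ_iff h2 hv hC h0 h1).2 hsq⟩
  · intro h
    refine h ConicArc.infinitePoint ConicArc.infinitePoint_mem_conic ?_
    rw [ConicArc.infinitePoint, ConicArc.mk_mem_lineZ]
    simp
  · rintro ⟨l, hl, P₁, P₂, hne, hl₁, hl₂, hi₁, hi₂, hf₁, hf₂⟩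
    induction l using Projectivization.ind with
    | h u hu =>
    induction P₁ using Projectivization.ind with
    | h v hv =>
    induction P₂ using Projectivization.ind with
    | h w hw =>
    rw [ConicArc.mk_mem_points_mk] at hl₁ hl₂
    -- This discards `(0, 0, 1)`, which lies on the tangent `X = 0`.
    have hv0 : v 0 ≠ 0 := fun h => ConicArc.not_isInternal_of_eq_zero hv h hi₁
    have hw0 : w 0 ≠ 0 := fun h => ConicArc.not_isInternal_of_eq_zero hw h hi₂
    have hv2 := (ConicArc.eq_zero_of_isFree h2 hq hv hi₁.1 hf₁).resolve_right fun h => hv0 h.1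
    have hw2 := (ConicArc.eq_zero_of_isFree h2 hq hw hi₂.1 hf₂).resolve_right fun h => hw0 h.1
    have hdet : v 0 * w 1 - w 0 * v 1 ≠ 0 := by
      intro h
      apply hne
      rw [Projectivization.mk_eq_mk_iff']
      refine ⟨v 0 / w 0, funext fun i => ?_⟩
      fin_cases i
      · simp [hw0]
      · simp only [Fin.mk_one, Pi.smul_apply, smul_eq_mul]
        field_simp
        linear_combination h
      · simp [hv2, hw2]
    -- Two distinct points of `Z = 0` determine that line; `u 1 = 0` already puts the conic point
    -- `(0, 1, 0)` on it.
    have hu1 : u 1 = 0 := (mul_eq_zero.1 (?_ : (v 0 * w 1 - w 0 * v 1) * u 1 = 0)).resolve_left hdet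
    · exact hl _ ConicArc.infinitePoint_mem_conic ((ConicArc.infinitePoint_mem_points hu).2 hu1)
    · rw [hv2] at hl₁
      rw [hw2] at hl₂
      linear_combination v 0 * hl₂ - w 0 * hl₁
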